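/- **Conventions.** Let $B_{48}$ be the braid group on the points $1<1'<2<2'<\dots<24<24'$ of the real axis, given by Artin's presentation; its standard generators are the counterclockwise half-twists of two consecutive points along the real segment. For two points $a<b$ let $Z_{ab}$ be the half-twist along the path from $a$ to $b$ below the real axis; algebraically, if $\sigma_i,\sigma_{i+1},\dots$ are the generators at the consecutive points from $a$ on, then $Z_{ab}=\sigma_i$ if $b$ is the next point after $a$, and otherwise $Z_{ab}=\sigma^{-1}Z_{ac}\,\sigma$, where $c$ is the point preceding $b$ and $\sigma$ is the generator exchanging $c$ and $b$. Write $a^b=b^{-1}ab$. For a factorized expression (finite sequence of factors) $g_1\cdots g_k$ in a group, a Hurwitz move replaces two neighbouring factors $a\cdot b$ by $aba^{-1}\cdot a$ or by $b\cdot b^{-1}ab$; Hurwitz equivalence means equivalence by finitely many such moves; $(g_1\cdots g_k)^h=g_1^h\cdots g_k^h$; and $g_1\cdots g_k$ is *invariant under* $h$ if it is Hurwitz equivalent to $g_1^h\cdots g_k^h$. The following symbols denote products as braids and, where they occur as factors, the displayed factorizations: $$Z^2_{ii',j}=Z^2_{i'j}\cdot Z^2_{ij},\qquad Z^2_{i,jj'}=Z^2_{ij'}\cdot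 Z^2_{ij},\qquad Z^2_{ii',jj'}=Z^2_{i',jj'}\cdot Z^2_{i,jj'},$$ $$Z^3_{ii',j}=(Z^3_{ij})^{Z_{ii'}}\cdot Z^3_{ij}\cdot (Z^3_{ij})^{Z_{ii'}^{-1}},\qquad Z^3_{i,jj'}=(Z^3_{ij})^{Z_{jj'}}\cdot Z^3_{ij}\cdot (Z^3_{ij})^{Z_{jj'}^{-1}}$$ (a single point $i$ or $j$ may also be a primed one). **The factorization $\varphi_2$.** Put $$\tilde Z_{1'2}=(Z_{1'2})^{Z^2_{22',20}Z^2_{22',13}},\qquad \tilde Z_{12'}=\left((Z_{1'2})^{Z_{11'}Z_{22'}}\right)^{Z^2_{22',20}Z^2_{22',13}},$$ $$F=Z^3_{22',13}\cdot Z^2_{13'\,20}\cdot (Z^2_{13\,20})^{Z^2_{22',13}}\cdot (Z^3_{22',20})^{Z^2_{22',13}}\cdot \tilde Z_{12'}\cdot\tilde Z_{1'2},$$ $$\begin{aligned}G={}&Z^2_{5',13\,13'}\cdot Z^3_{22',5}\cdot (Z^3_{5',20\,20'})^{Z^2_{5',13\,13'}}\cdot (Z^2_{5',13\,13'})^{Z^{-2}_{13\,13',20\,20'}}\cdot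 (Z_{55'})^{Z^2_{22',5}Z^2_{5',20\,20'}Z^2_{5',13\,13'}}\\&\cdot (Z^2_{11',5'})^{Z^2_{5',20\,20'}Z^2_{5',13\,13'}}\cdot Z^2_{11',5},\end{aligned}$$ $$\begin{aligned}\varphi_2={}&Z^2_{22',4}\cdot Z^2_{4',55'}\cdot Z^3_{11',4}\cdot (Z^3_{4',13\,13'})^{Z^2_{4',55'}}\cdot (Z^2_{22',4})^{Z^2_{11',4}}\cdot (Z^2_{4',55'})^{Z^{-2}_{55',13\,13'}}\\&\cdot (Z_{44'})^{Z^2_{4',13\,13'}Z^2_{4',55'}Z^2_{22',4}Z^2_{11',4}}\cdot (Z^2_{4,20\,20'})^{Z^2_{4,13\,13'}Z^2_{4,55'}Z^2_{44'}Z^2_{22',4}Z^2_{11',4}}\cdot (Z^2_{4',20\,20'})^{Z^2_{4',13\,13'}Z^2_{4',55'}}\\&\cdot\left(G\cdot\left(F\cdot F^{Z_{20\,20'}^{-1}Z_{13\,13'}^{-1}}\right)^{Z^2_{22',5}Z^2_{11',5}}\right)^{Z^2_{22',4}Z^2_{11',4}}.\end{aligned}$$ **Lemma.** For all $p,q,r\in\mathbb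 Z$ the factorization $\varphi_2$ is invariant under $$(Z_{44'}Z_{55'})^p\,(Z_{13\,13'}Z_{20\,20'})^q\,(Z_{11'}Z_{22'})^r .$$ -/

import Mathlib

/-! ## The braid group, half-twists -/

/-- Artin's relations on `σ₀, …, σ₄₆`. -/
def braidRels : Set (FreeGroup (Fin 47)) :=
  {w | ∃ i j : Fin 47, (i : ℕ) + 2 ≤ j ∧
      w = FreeGroup.of i * FreeGroup.of j * (FreeGroup.of j * FreeGroup.of i)⁻¹} ∪
  {w | ∃ i j : Fin 47, (i : ℕ) + 1 = j ∧
      w = FreeGroup.of i * FreeGroup.of j * FreeGroup.of i *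
        (FreeGroup.of j * FreeGroup.of i * FreeGroup.of j)⁻¹}

/-- The braid group on 48 strands, in Artin's presentation. The strands are the points
`0 < 1 < ⋯ < 47` of the real axis. -/
abbrev B48 : Type := PresentedGroup braidRels

/-- The Artin generator `σₖ`: the positive half-twist of the consecutive points `k`, `k + 1`
along the real segment (set to `1` for `k ≥ 47`, which is never used). -/
def sigma (k : ℕ) : B48 :=
  if h : k < 47 then PresentedGroup.of ⟨k, h⟩ else 1

/-- Conjugation of braids, `a ^ b = b⁻¹ a b`. -/
def cj (a b : B48) : B48 := b⁻¹ * a * b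

/-- `Z i j`, for `i < j ≤ 47`: the positive half-twist of the points `i` and `j` along the path
below the real axis. One has `Z_{i,i+1} = σᵢ` and `Z_{i,j+1} = (Z_{i,j}) ^ {σⱼ}`. -/
def Z (i : ℕ) : ℕ → B48
  | 0 => 1
  | j + 1 => if i < j then cj (Z i j) (sigma j) else sigma i

/-! ## Factorizations and Hurwitz equivalence -/

/-- A factorized expression `g₁ ⋯ gₖ` is the list of its factors. -/
abbrev Factorization (G : Type*) := List G

/-- One Hurwitz move: two neighbouring factors `a, b` become `a b a⁻¹, a` or `b, b⁻¹ a b`. -/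
inductive HurwitzMove {G : Type*} [Group G] : Factorization G → Factorization G → Prop
  | left (l r : Factorization G) (a b : G) :
      HurwitzMove (l ++ a :: b :: r) (l ++ (a * b * a⁻¹) :: a :: r)
  | right (l r : Factorization G) (a b : G) :
      HurwitzMove (l ++ a :: b :: r) (l ++ b :: (b⁻¹ * a * b) :: r)

/-- Hurwitz equivalence: a finite number of Hurwitz moves. -/
def HurwitzEquiv {G : Type*} [Group G] : Factorization G → Factorization G → Prop :=
  Relation.ReflTransGen HurwitzMove

/-- `g₁ ⋯ gₖ` is invariant under `h` if it is Hurwitz equivalent to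
`(h⁻¹ g₁ h) ⋯ (h⁻¹ gₖ h)`. -/
def IsInvariantUnder {G : Type*} [Group G] (l : Factorization G) (h : G) : Prop :=
  HurwitzEquiv l (l.map fun g => h⁻¹ * g * h)

/-! ## Building blocks -/

/-- `F ^ b`: every factor is conjugated by `b`. -/
def cjF (F : Factorization B48) (b : B48) : Factorization B48 := F.map fun a => cj a b

/-- The point `j` on the fibre (`1 ≤ j ≤ 24`); the points are ordered as
`1 < 1' < 2 < 2' < ⋯ < 24 < 24'`. -/
def pt (j : ℕ) : ℕ := 2 * j - 2

/-- The point `j'` on the fibre (`1 ≤ j ≤ 24`). -/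
def pt' (j : ℕ) : ℕ := 2 * j - 1

/-- The pair of points `j j'`. -/
def dbl (j : ℕ) : List ℕ := [pt j, pt' j]

/-- The half-twist `Z_{j j'}`. -/
def ZZ (j : ℕ) : B48 := Z (pt j) (pt' j)

/-- The factorization of the full twist `Z²_{A,B}` of the points of `A` around those of `B`, every
point of `A` being to the left of every point of `B`:
`Z²_{i i',j} = Z²_{i' j} · Z²_{i j}`, `Z²_{i,j j'} = Z²_{i j'} · Z²_{i j}` and
`Z²_{i i',j j'} = Z²_{i',j j'} · Z²_{i,j j'}`. -/
def nodes (A B : List ℕ) : Factorization B48 :=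
  A.reverse.flatMap fun a => B.reverse.map fun b => Z a b ^ 2

/-- The braid `Z²_{A,B}`. -/
def Z2 (A B : List ℕ) : B48 := (nodes A B).prod

/-- `(c) ^ h · c · (c) ^ {h⁻¹}`. -/
def threeCusps (c h : B48) : Factorization B48 := [cj c h, c, cj c h⁻¹]

/-- `Z³_{i i',j}`, where `b` is the position of the single point. -/
def cuspsL (i : ℕ) (b : ℕ) : Factorization B48 := threeCusps (Z (pt i) b ^ 3) (ZZ i)

/-- `Z³_{i,j j'}`, where `a` is the position of the single point. -/
def cuspsR (a : ℕ) (j : ℕ) : Factorization B48 := threeCusps (Z a (pt j) ^ 3) (ZZ j)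

/-! ## The local monodromy at the 6-point -/

/-- `Z̃_{1' 2}`: the half-twist along the path which arises from the segment `[1', 2]` by the full
twists `Z²_{2 2',20} Z²_{2 2',13}`. -/
def Ztilde1p2 : B48 :=
  cj (Z (pt' 1) (pt 2)) (Z2 (dbl 2) [pt 20] * Z2 (dbl 2) [pt 13])

/-- `Z̃_{1 2'}`: the half-twist along the parallel path, which arises in the same way from the path
from `1` to `2'` going above `1'` and below `2`; the half-twist along the latter path
is `Z_{1' 2} ^ {Z_{1 1'} Z_{2 2'}}`. -/
def Ztilde12p : B48 :=
  cj (cj (Z (pt' 1) (pt 2)) (ZZ 1 * ZZ 2)) (Z2 (dbl 2) [pt 20] * Z2 (dbl 2) [pt 13])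

/-- The factorization `F`. -/
def F2 : Factorization B48 :=
  cuspsL 2 (pt 13) ++
  nodes [pt' 13] [pt 20] ++
  cjF (nodes [pt 13] [pt 20]) (Z2 (dbl 2) [pt 13]) ++
  cjF (cuspsL 2 (pt 20)) (Z2 (dbl 2) [pt 13]) ++
  [Ztilde12p, Ztilde1p2]

/-- The factorization `G`. -/
def G2 : Factorization B48 :=
  nodes [pt' 5] (dbl 13) ++
  cuspsL 2 (pt 5) ++
  cjF (cuspsR (pt' 5) 20) (Z2 [pt' 5] (dbl 13)) ++
  cjF (nodes [pt' 5] (dbl 13)) (Z2 (dbl 13) (dbl 20))⁻¹ ++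
  [cj (ZZ 5) (Z2 (dbl 2) [pt 5] * Z2 [pt' 5] (dbl 20) * Z2 [pt' 5] (dbl 13))] ++
  cjF (nodes (dbl 1) [pt' 5]) (Z2 [pt' 5] (dbl 20) * Z2 [pt' 5] (dbl 13)) ++
  nodes (dbl 1) [pt 5]

/-- The local braid monodromy `φ₂`. -/
def phi2 : Factorization B48 :=
  nodes (dbl 2) [pt 4] ++
  nodes [pt' 4] (dbl 5) ++
  cuspsL 1 (pt 4) ++
  cjF (cuspsR (pt' 4) 13) (Z2 [pt' 4] (dbl 5)) ++
  cjF (nodes (dbl 2) [pt 4]) (Z2 (dbl 1) [pt 4]) ++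
  cjF (nodes [pt' 4] (dbl 5)) (Z2 (dbl 5) (dbl 13))⁻¹ ++
  [cj (ZZ 4) (Z2 [pt' 4] (dbl 13) * Z2 [pt' 4] (dbl 5) * Z2 (dbl 2) [pt 4] *
    Z2 (dbl 1) [pt 4])] ++
  cjF (nodes [pt 4] (dbl 20)) (Z2 [pt 4] (dbl 13) * Z2 [pt 4] (dbl 5) * ZZ 4 ^ 2 *
    Z2 (dbl 2) [pt 4] * Z2 (dbl 1) [pt 4]) ++
  cjF (nodes [pt' 4] (dbl 20)) (Z2 [pt' 4] (dbl 13) * Z2 [pt' 4] (dbl 5)) ++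
  cjF (G2 ++ cjF (F2 ++ cjF F2 ((ZZ 20)⁻¹ * (ZZ 13)⁻¹)) (Z2 (dbl 2) [pt 5] * Z2 (dbl 1) [pt 5]))
    (Z2 (dbl 2) [pt 4] * Z2 (dbl 1) [pt 4])

/-! Write `a`, `b`, `c` for the twists at 4 and 5, at 13 and 20, and at 1 and 2. The braids leaving
a factorization invariant are closed under products and inverses, so it suffices to treat `a`, `b`
and `c` separately.

Apart from the two copies of `F2`, the factorization consists of short blocks, conjugated by braids
that commute with `b` and `c`. On each block `b` and `c` either fix every factor or shift the
factors by one place and keep the product; a shift is undone by moving the last factor to the front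
(`isInvariantUnder_of_shift`). The blocks of `F2` behave in the same way under `c`, which settles
`c`.

For `b` on `F2 · F2 ^ {b⁻¹}`, let `P` be the product of `F2`. Then `(P b)² c²` is the full twist of
the eight points other than 4, 4', 5, 5', and it commutes with the factors of `F2`. Since a
factorization is invariant under its own product, `F2` is invariant under `b P b`, and rotating the
two halves past each other gives invariance under `b` (`isInvariantUnder_append_conjList`).

Finally, the product of `phi2` times `a b c` is the full twist of the twelve points involved, which
commutes with every factor. So `a` is a product of braids under which `phi2` is already known to be
invariant.

The braid identities used are checked on words in the eleven half-twists of consecutive points among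
the twelve, by handle reduction evaluated in the kernel. Only its soundness is needed: a word
reduced to the empty word is trivial in any group satisfying the relations. -/

/-! ## Hurwitz equivalence -/

section Hurwitz

variable {G : Type*} [Group G]

/-- The factorization conjugated by `h`. -/
def conjList (l : Factorization G) (h : G) : Factorization G := l.map fun g => h⁻¹ * g * h

theorem conjList_append (l m : Factorization G) (h : G) :
    conjList (l ++ m) h = conjList l h ++ conjList m h := List.map_append

theorem conjList_conjList (l : Factorization G) (h k : G) :
    conjList (conjList l h) k = conjList l (h * k) := by
  simp [conjList, mul_assoc]

theorem conjList_one (l : Factorization G) : conjList l 1 = l := by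
  simp [conjList]

theorem conjList_eq_self {l : Factorization G} {h : G} (H : ∀ g ∈ l, Commute h g) :
    conjList l h = l := by
  conv_rhs => rw [← List.map_id l]
  refine List.map_congr_left fun g hg => ?_
  rw [mul_assoc, ← (H g hg).eq, inv_mul_cancel_left, id]

theorem prod_conjList (l : Factorization G) (h : G) :
    (conjList l h).prod = h⁻¹ * l.prod * h := by
  induction l with
  | nil => simp [conjList]
  | cons a l ih => simp only [conjList, List.map_cons, List.prod_cons] at ih ⊢; rw [ih]; group

theorem HurwitzMove.symm {l m : Factorization G} (h : HurwitzMove l m) : HurwitzMove m l := by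
  cases h with
  | left l r a b => simpa [mul_assoc] using HurwitzMove.right l r (a * b * a⁻¹) a
  | right l r a b => simpa [mul_assoc] using HurwitzMove.left l r b (b⁻¹ * a * b)

theorem HurwitzMove.append_left {l m : Factorization G} (h : HurwitzMove l m)
    (k : Factorization G) : HurwitzMove (k ++ l) (k ++ m) := by
  cases h with
  | left l r a b => simpa using HurwitzMove.left (k ++ l) r a b
  | right l r a b => simpa using HurwitzMove.right (k ++ l) r a b

theorem HurwitzMove.append_right {l m : Factorization G} (h : HurwitzMove l m)
    (k : Factorization G) : HurwitzMove (l ++ k) (m ++ k) := by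
  cases h with
  | left l r a b => simpa using HurwitzMove.left l (r ++ k) a b
  | right l r a b => simpa using HurwitzMove.right l (r ++ k) a b

theorem HurwitzMove.conjList {l m : Factorization G} (H : HurwitzMove l m) (h : G) :
    HurwitzMove (conjList l h) (conjList m h) := by
  cases H with
  | left l r a b =>
    simpa [_root_.conjList, mul_assoc] using
      HurwitzMove.left (_root_.conjList l h) (_root_.conjList r h)
        (h⁻¹ * a * h) (h⁻¹ * b * h)
  | right l r a b =>
    simpa [_root_.conjList, mul_assoc] using
      HurwitzMove.right (_root_.conjList l h) (_root_.conjList r h)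
        (h⁻¹ * a * h) (h⁻¹ * b * h)

theorem HurwitzEquiv.refl (l : Factorization G) : HurwitzEquiv l l := Relation.ReflTransGen.refl

theorem HurwitzEquiv.trans {l m n : Factorization G} (h : HurwitzEquiv l m)
    (h' : HurwitzEquiv m n) : HurwitzEquiv l n := Relation.ReflTransGen.trans h h'

theorem HurwitzEquiv.symm {l m : Factorization G} (h : HurwitzEquiv l m) : HurwitzEquiv m l :=
  have : Std.Symm (HurwitzMove (G := G)) := ⟨fun _ _ => HurwitzMove.symm⟩
  Std.Symm.symm (r := Relation.ReflTransGen (HurwitzMove (G := G))) _ _ h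

theorem HurwitzEquiv.append {l m l' m' : Factorization G} (h : HurwitzEquiv l m)
    (h' : HurwitzEquiv l' m') : HurwitzEquiv (l ++ l') (m ++ m') :=
  (Relation.ReflTransGen.lift (p := HurwitzMove) (· ++ l')
    (fun _ _ H => HurwitzMove.append_right H l') _ _ h).trans
    (Relation.ReflTransGen.lift (p := HurwitzMove) (m ++ ·)
      (fun _ _ H => HurwitzMove.append_left H m) _ _ h')

theorem HurwitzEquiv.conjList {l m : Factorization G} (H : HurwitzEquiv l m) (h : G) :
    HurwitzEquiv (conjList l h) (conjList m h) :=
  Relation.ReflTransGen.lift (p := HurwitzMove) (_root_.conjList · h)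
    (fun _ _ H => HurwitzMove.conjList H h) _ _ H

/-- Moving the first factor to the end. -/
theorem hurwitzEquiv_cons (a : G) (l : Factorization G) :
    HurwitzEquiv (a :: l) (l ++ [l.prod⁻¹ * a * l.prod]) := by
  induction l generalizing a with
  | nil => simpa using HurwitzEquiv.refl [a]
  | cons b l ih =>
    have h1 : HurwitzEquiv (a :: b :: l) ([b] ++ (b⁻¹ * a * b) :: l) :=
      .single (HurwitzMove.right [] l a b)
    have h2 := h1.trans ((HurwitzEquiv.refl [b]).append (ih (b⁻¹ * a * b)))
    simpa [mul_assoc] using h2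

/-- Moving the last factor to the front. -/
theorem hurwitzEquiv_concat (l : Factorization G) (a : G) :
    HurwitzEquiv (l ++ [a]) ((l.prod * a * l.prod⁻¹) :: l) := by
  simpa [mul_assoc] using (hurwitzEquiv_cons (l.prod * a * l.prod⁻¹) l).symm

/-- Moving the first factors to the end, each of them becoming conjugated by the product. -/
theorem hurwitzEquiv_rotate (l m : Factorization G) :
    HurwitzEquiv (l ++ m) (m ++ conjList l (l ++ m).prod) := by
  induction l generalizing m with
  | nil => simpa [conjList] using HurwitzEquiv.refl m
  | cons a l ih =>
    have h1 := hurwitzEquiv_cons a (l ++ m)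
    have h2 := ih (m ++ [(l ++ m).prod⁻¹ * a * (l ++ m).prod])
    rw [← List.append_assoc] at h2
    have h3 := h1.trans h2
    simpa [conjList, mul_assoc] using h3

/-! ### Criteria for invariance and closure properties. -/

theorem IsInvariantUnder.iff_conjList {l : Factorization G} {h : G} :
    IsInvariantUnder l h ↔ HurwitzEquiv l (conjList l h) := Iff.rfl

/-- A factorization is invariant under its product. -/
theorem isInvariantUnder_prod (l : Factorization G) : IsInvariantUnder l l.prod := by
  simpa using! hurwitzEquiv_rotate l []

theorem isInvariantUnder_of_commute {l : Factorization G} {h : G} (H : ∀ g ∈ l, Commute h g) :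
    IsInvariantUnder l h := by
  rw [IsInvariantUnder.iff_conjList, conjList_eq_self H]
  exact HurwitzEquiv.refl l

namespace IsInvariantUnder

variable {l m : Factorization G} {h k : G}

theorem mul (H : IsInvariantUnder l h) (K : IsInvariantUnder l k) :
    IsInvariantUnder l (h * k) := by
  rw [iff_conjList, ← conjList_conjList]
  exact K.trans (HurwitzEquiv.conjList H k)

theorem inv (H : IsInvariantUnder l h) : IsInvariantUnder l h⁻¹ := by
  have H' := HurwitzEquiv.conjList H.symm h⁻¹
  change HurwitzEquiv (conjList (conjList l h) h⁻¹) _ at H'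
  rwa [conjList_conjList, mul_inv_cancel, conjList_one] at H'

theorem zpow (H : IsInvariantUnder l h) (n : ℤ) : IsInvariantUnder l (h ^ n) := by
  induction n with
  | zero => exact isInvariantUnder_of_commute fun g _ => by simp
  | succ n ih => rw [zpow_add_one]; exact ih.mul H
  | pred n ih => rw [zpow_sub_one]; exact ih.mul H.inv

theorem append (H : IsInvariantUnder l h) (K : IsInvariantUnder m h) :
    IsInvariantUnder (l ++ m) h := by
  rw [iff_conjList, conjList_append]
  exact HurwitzEquiv.append H K

theorem conjList (H : IsInvariantUnder l h) (hk : Commute h k) :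
    IsInvariantUnder (conjList l k) h := by
  rw [iff_conjList, conjList_conjList, ← hk.eq, ← conjList_conjList]
  exact HurwitzEquiv.conjList H k

end IsInvariantUnder

/-- If conjugation by `h` shifts the factors by one place and fixes the product, then the
factorization is invariant under `h`. -/
theorem isInvariantUnder_of_shift {l : Factorization G} {h : G}
    (H : conjList l.tail h = l.dropLast) (K : Commute h l.prod) : IsInvariantUnder l h := by
  rcases List.eq_nil_or_concat' l with rfl | ⟨m, a, rfl⟩
  · exact HurwitzEquiv.refl _
  have e := hurwitzEquiv_concat m a
  rw [IsInvariantUnder.iff_conjList]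
  rw [List.dropLast_concat] at H
  rcases hl : m ++ [a] with _ | ⟨b, t⟩
  · simp at hl
  rw [hl] at e H K
  have hp := congrArg List.prod hl
  rw [List.prod_append, List.prod_singleton] at hp
  -- The conjugated list is `h⁻¹ b h` followed by `m`, and its product is still `m.prod * a`; this
  -- determines its first factor.
  have hb : h⁻¹ * b * h = m.prod * a * m.prod⁻¹ := by
    have h1 := prod_conjList (b :: t) h
    rw [mul_assoc, ← K.eq, inv_mul_cancel_left, ← hp] at h1
    rw [← h1, ← H]
    simp [conjList]
  have h2 : conjList (b :: t) h = (m.prod * a * m.prod⁻¹) :: m := by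
    rw [← hb, ← H]; rfl
  rw [h2]
  exact e

/-- Let `F` be invariant under `c`, and let `(P b)² c` commute with the factors of `F`, where `P`
is the product of `F`. Then `F · F ^ {b⁻¹}` is invariant under `b`. -/
theorem isInvariantUnder_append_conjList {l : Factorization G} {b c : G}
    (H : IsInvariantUnder l c)
    (K : ∀ g ∈ l, Commute (l.prod * b * l.prod * b * c) g) :
    IsInvariantUnder (l ++ conjList l b⁻¹) b := by
  -- With `P = l.prod`, one has `b P b = P⁻¹ · (P b P b c) · c⁻¹`, and `l` is invariant under each
  -- of the three factors.
  have h1 : IsInvariantUnder l (b * l.prod * b) := by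
    have := ((isInvariantUnder_prod l).inv.mul (isInvariantUnder_of_commute K)).mul H.inv
    convert this using 1
    group
  -- First replace `l ^ {b⁻¹}` by `l ^ {P b⁻¹}`, using invariance under `P`; then carry this second
  -- half to the front across `l`.
  have h2 : HurwitzEquiv (l ++ conjList l b⁻¹) (conjList l (b⁻¹ * l.prod⁻¹) ++ l) := by
    have h3 := (hurwitzEquiv_rotate (conjList l (b⁻¹ * l.prod⁻¹)) l).symm
    rw [conjList_conjList, List.prod_append, prod_conjList,
      show b⁻¹ * l.prod⁻¹ * ((b⁻¹ * l.prod⁻¹)⁻¹ * l.prod * (b⁻¹ * l.prod⁻¹) * l.prod) =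
        l.prod * b⁻¹ by group, ← conjList_conjList] at h3
    exact ((HurwitzEquiv.refl l).append
      (HurwitzEquiv.conjList (isInvariantUnder_prod l) b⁻¹)).trans h3
  rw [IsInvariantUnder.iff_conjList, conjList_append, conjList_conjList, inv_mul_cancel,
    conjList_one]
  refine h2.trans (HurwitzEquiv.append ?_ (HurwitzEquiv.refl l))
  -- Conjugating `l ~ l ^ {b P b}` by `b⁻¹ P⁻¹` turns the right-hand side into `l ^ b`, as required
  -- for the first half.
  have h3 := (HurwitzEquiv.conjList h1 (b⁻¹ * l.prod⁻¹))
  change HurwitzEquiv _ (conjList (conjList l _) _) at h3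
  rwa [conjList_conjList, show b * l.prod * b * (b⁻¹ * l.prod⁻¹) = b by group] at h3

end Hurwitz

/-! ## Braid words and handle reduction -/

/-- A letter of a braid word: a generator or its inverse. -/
inductive BraidLetter
  | pos (k : ℕ)
  | neg (k : ℕ)

/-- Words in the generators and their inverses. -/
abbrev BraidWord := List BraidLetter

namespace BraidLetter

/-- The inverse letter. -/
def inv : BraidLetter → BraidLetter
  | pos k => neg k
  | neg k => pos k

/-- The value of a letter. -/
def val {G : Type*} [Group G] (g : ℕ → G) : BraidLetter → G
  | pos k => g k
  | neg k => (g k)⁻¹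

/-- A word for `(g a)⁻¹ y (g a)`; the braid relation is used only for generators below `n`. -/
def conjPos (n a : ℕ) : BraidLetter → BraidWord
  | pos b =>
    match Nat.beq b (a + 1) with
    | true =>
      match Nat.blt b n with
      | true => [pos b, pos a, neg b]
      | false => [neg a, pos b, pos a]
    | false =>
      match Nat.beq (b + 1) a with
      | true => [neg a, pos b, pos a]
      | false => [pos b]
  | neg b =>
    match Nat.beq b (a + 1) with
    | true =>
      match Nat.blt b n with
      | true => [pos b, neg a, neg b]
      | false => [neg a, neg b, pos a]
    | false =>
      match Nat.beq (b + 1) a with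
      | true => [neg a, neg b, pos a]
      | false => [neg b]

/-- A word for `(g a) y (g a)⁻¹`; the braid relation is used only for generators below `n`. -/
def conjNeg (n a : ℕ) : BraidLetter → BraidWord
  | pos b =>
    match Nat.beq b (a + 1) with
    | true =>
      match Nat.blt b n with
      | true => [neg b, pos a, pos b]
      | false => [pos a, pos b, neg a]
    | false =>
      match Nat.beq (b + 1) a with
      | true => [pos a, pos b, neg a]
      | false => [pos b]
  | neg b =>
    match Nat.beq b (a + 1) with
    | true =>
      match Nat.blt b n with
      | true => [neg b, neg a, pos b]
      | false => [pos a, neg b, neg a]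
    | false =>
      match Nat.beq (b + 1) a with
      | true => [pos a, neg b, neg a]
      | false => [neg b]

end BraidLetter

namespace BraidWord

open BraidLetter

/-- Search in a reversed word for the letter that closes a handle with a following letter `a`.
The result is the interior of the handle and the reversed word in front of it. -/
def splitAtNeg (a : ℕ) : BraidWord → BraidWord → Option (BraidWord × BraidWord)
  | [], _ => none
  | pos b :: l, m =>
    match Nat.beq b a with
    | true => none
    | false =>
      match Nat.beq (b + 1) a with
      | true => none
      | false => splitAtNeg a l (pos b :: m)
  | neg b :: l, m =>
    match Nat.beq b a with
    | true => some (m, l)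
    | false =>
      match Nat.beq (b + 1) a with
      | true => none
      | false => splitAtNeg a l (neg b :: m)

/-- The same search for a following letter `a⁻¹`. -/
def splitAtPos (a : ℕ) : BraidWord → BraidWord → Option (BraidWord × BraidWord)
  | [], _ => none
  | neg b :: l, m =>
    match Nat.beq b a with
    | true => none
    | false =>
      match Nat.beq (b + 1) a with
      | true => none
      | false => splitAtPos a l (neg b :: m)
  | pos b :: l, m =>
    match Nat.beq b a with
    | true => some (m, l)
    | false =>
      match Nat.beq (b + 1) a with
      | true => none
      | false => splitAtPos a l (pos b :: m)

/-- Dehornoy's handle reduction: the word is the reverse of the first list followed by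
the second one. -/
def handleReduce (n : ℕ) : ℕ → BraidWord → BraidWord → Option BraidWord
  | 0, _, _ => none
  | _ + 1, l, [] => some l
  | k + 1, l, pos a :: r =>
    match splitAtNeg a l [] with
    | none => handleReduce n k (pos a :: l) r
    | some (m, l') => handleReduce n k l' (m.flatMap (conjPos n a) ++ r)
  | k + 1, l, neg a :: r =>
    match splitAtPos a l [] with
    | none => handleReduce n k (neg a :: l) r
    | some (m, l') => handleReduce n k l' (m.flatMap (conjNeg n a) ++ r)

/-- Whether handle reduction, in at most `k` steps, shows a word to be trivial. -/
def reducesToOne (n k : ℕ) (w : BraidWord) : Bool :=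
  match handleReduce n k [] w with
  | some [] => true
  | _ => false

/-! ### Operations on words and Boolean tests. -/

/-- The inverse word. -/
def inv (w : BraidWord) : BraidWord := (w.map BraidLetter.inv).reverse

/-- The word for `b⁻¹ a b`. -/
def conj (a b : BraidWord) : BraidWord := inv b ++ (a ++ b)

/-- The word for `a ^ n`. -/
def pow (a : BraidWord) : ℕ → BraidWord
  | 0 => []
  | n + 1 => pow a n ++ a

/-- Whether handle reduction shows two words to be equal. -/
def equal (n k : ℕ) (u v : BraidWord) : Bool := reducesToOne n k (u ++ inv v)

/-- Whether handle reduction shows two words to commute. -/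
def commuting (n k : ℕ) (u v : BraidWord) : Bool := equal n k (u ++ v) (v ++ u)

/-- Whether handle reduction shows two lists of words to be equal. -/
def equalLists (n k : ℕ) : List BraidWord → List BraidWord → Bool
  | [], [] => true
  | u :: l, v :: m => equal n k u v && equalLists n k l m
  | _, _ => false

/-- The words for `cjF F b`. -/
def conjAll (F : List BraidWord) (b : BraidWord) : List BraidWord := F.map fun a => conj a b

/-- Whether conjugation by `h` fixes all words of the list, or shifts them by one place and
fixes their product. -/
def fixesOrShifts (n k : ℕ) (h : BraidWord) (L : List BraidWord) : Bool :=
  L.all (commuting n k h) ||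
    (equalLists n k (conjAll L.tail h) L.dropLast && commuting n k h L.flatten)

/-- The words of a list of blocks; a block `(L, b)` stands for the words of `L` conjugated by
`b`. -/
def blockWords (B : List (List BraidWord × BraidWord)) : List BraidWord :=
  B.flatMap fun b => conjAll b.1 b.2

/-- A word for the product of all words of a list of blocks. -/
def blockProd (B : List (List BraidWord × BraidWord)) : BraidWord :=
  B.flatMap fun b => conj b.1.flatten b.2

/-- Whether every block is fixed or shifted by `h`, and the conjugating words commute
with `h`. -/
def fixesOrShiftsBlocks (n k : ℕ) (h : BraidWord) (B : List (List BraidWord × BraidWord)) :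
    Bool :=
  B.all fun b => fixesOrShifts n k h b.1 && commuting n k h b.2

/-! ### Correctness -/

section Correctness

variable {G : Type*} [Group G] {g : ℕ → G} {n k : ℕ}

/-- The value of a word. -/
def val (g : ℕ → G) (w : BraidWord) : G := (w.map (BraidLetter.val g)).prod

@[simp] theorem val_nil : val g [] = 1 := rfl

@[simp] theorem val_cons (x : BraidLetter) (w : BraidWord) :
    val g (x :: w) = x.val g * val g w := by simp [val]

@[simp] theorem val_append (u v : BraidWord) : val g (u ++ v) = val g u * val g v := by
  simp [val]

@[simp] theorem val_inv (w : BraidWord) : val g (inv w) = (val g w)⁻¹ := by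
  induction w with
  | nil => simp [inv]
  | cons x w ih =>
    have : inv (x :: w) = inv w ++ [x.inv] := by simp [inv]
    rw [this, val_append, ih]
    cases x <;> simp [BraidLetter.inv, BraidLetter.val]

@[simp] theorem val_conj (a b : BraidWord) :
    val g (conj a b) = (val g b)⁻¹ * val g a * val g b := by
  simp [conj, mul_assoc]

@[simp] theorem val_pow (a : BraidWord) (m : ℕ) : val g (pow a m) = val g a ^ m := by
  induction m with
  | zero => simp [pow]
  | succ m ih => simp [pow, ih, pow_succ]

theorem val_flatten (L : List BraidWord) : val g L.flatten = (L.map (val g)).prod := by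
  induction L with
  | nil => rfl
  | cons w L ih => simp [ih]

theorem map_val_conjAll (L : List BraidWord) (b : BraidWord) :
    (conjAll L b).map (val g) = conjList (L.map (val g)) (val g b) := by
  simp [conjAll, conjList]

theorem val_blockProd (B : List (List BraidWord × BraidWord)) :
    val g (blockProd B) = ((blockWords B).map (val g)).prod := by
  induction B with
  | nil => rfl
  | cons b B ih =>
    simp only [blockProd, blockWords, List.flatMap_cons, val_append, List.map_append,
      List.prod_append] at ih ⊢
    rw [ih, val_conj, map_val_conjAll, prod_conjList, val_flatten]

/-- The relations of the braid group for the generators `g 0, …, g (n - 1)`. -/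
structure Relations (n : ℕ) (g : ℕ → G) : Prop where
  commute : ∀ i j, i + 2 ≤ j → Commute (g i) (g j)
  braid : ∀ i, i + 1 < n → g i * g (i + 1) * g i = g (i + 1) * g i * g (i + 1)

theorem Relations.commute_of_ne (hg : Relations n g) {a b : ℕ} (h1 : b ≠ a + 1)
    (h2 : b + 1 ≠ a) : Commute (g a) (g b) := by
  rcases lt_trichotomy a b with h | rfl | h
  · exact hg.commute _ _ (by omega)
  · exact Commute.refl _
  · exact (hg.commute _ _ (by omega)).symm

theorem Relations.conj_succ (hg : Relations n g) {a : ℕ} (h : a + 1 < n) :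
    g (a + 1) * g a * (g (a + 1))⁻¹ = (g a)⁻¹ * g (a + 1) * g a := by
  rw [mul_inv_eq_iff_eq_mul, mul_assoc, mul_assoc, eq_inv_mul_iff_mul_eq, ← mul_assoc,
    ← mul_assoc, hg.braid a h]

theorem Relations.conj_succ' (hg : Relations n g) {a : ℕ} (h : a + 1 < n) :
    (g (a + 1))⁻¹ * g a * g (a + 1) = g a * g (a + 1) * (g a)⁻¹ := by
  rw [eq_mul_inv_iff_mul_eq, mul_assoc, mul_assoc, inv_mul_eq_iff_eq_mul, ← mul_assoc,
    ← mul_assoc, hg.braid a h]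

/-- The braid relation is needed only for the letter `a + 1` below `n`. The neighbour `a - 1`, and
`a + 1` from `n` on, are conjugated literally; all other letters commute with `g a`. -/
theorem val_conjPos (hg : Relations n g) (a : ℕ) (x : BraidLetter) :
    val g (conjPos n a x) = (g a)⁻¹ * x.val g * g a := by
  cases x with
  | pos b =>
    simp only [conjPos]
    split
    next h =>
      obtain rfl := Nat.eq_of_beq_eq_true h
      split
      next h' =>
        simpa [BraidLetter.val, mul_assoc] using hg.conj_succ (by simpa [Nat.blt_eq] using h')
      next => simp [BraidLetter.val, mul_assoc]
    next h =>
      split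
      next => simp [BraidLetter.val, mul_assoc]
      next h' =>
        have := hg.commute_of_ne (Nat.ne_of_beq_eq_false h) (Nat.ne_of_beq_eq_false h')
        simp [BraidLetter.val, mul_assoc, ← this.eq]
  | neg b =>
    simp only [conjPos]
    split
    next h =>
      obtain rfl := Nat.eq_of_beq_eq_true h
      split
      next h' =>
        have := hg.conj_succ (by simpa [Nat.blt_eq] using h')
        simpa [BraidLetter.val, mul_assoc] using congrArg (·⁻¹) this
      next => simp [BraidLetter.val, mul_assoc]
    next h =>
      split
      next => simp [BraidLetter.val, mul_assoc]
      next h' =>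
        have := hg.commute_of_ne (Nat.ne_of_beq_eq_false h) (Nat.ne_of_beq_eq_false h')
        simp [BraidLetter.val, mul_assoc, ← this.inv_right.eq]

theorem val_conjNeg (hg : Relations n g) (a : ℕ) (x : BraidLetter) :
    val g (conjNeg n a x) = g a * x.val g * (g a)⁻¹ := by
  cases x with
  | pos b =>
    simp only [conjNeg]
    split
    next h =>
      obtain rfl := Nat.eq_of_beq_eq_true h
      split
      next h' =>
        simpa [BraidLetter.val, mul_assoc] using hg.conj_succ' (by simpa [Nat.blt_eq] using h')
      next => simp [BraidLetter.val, mul_assoc]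
    next h =>
      split
      next => simp [BraidLetter.val, mul_assoc]
      next h' =>
        have := hg.commute_of_ne (Nat.ne_of_beq_eq_false h) (Nat.ne_of_beq_eq_false h')
        simp [BraidLetter.val, this.eq]
  | neg b =>
    simp only [conjNeg]
    split
    next h =>
      obtain rfl := Nat.eq_of_beq_eq_true h
      split
      next h' =>
        have := hg.conj_succ' (by simpa [Nat.blt_eq] using h')
        simpa [BraidLetter.val, mul_assoc] using congrArg (·⁻¹) this
      next => simp [BraidLetter.val, mul_assoc]
    next h =>
      split
      next => simp [BraidLetter.val, mul_assoc]
      next h' =>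
        have := hg.commute_of_ne (Nat.ne_of_beq_eq_false h) (Nat.ne_of_beq_eq_false h')
        simp [BraidLetter.val, this.inv_right.eq]

theorem val_flatMap_conjPos (hg : Relations n g) (a : ℕ) (w : BraidWord) :
    val g (w.flatMap (conjPos n a)) = (g a)⁻¹ * val g w * g a := by
  induction w with
  | nil => simp
  | cons x w ih => rw [List.flatMap_cons, val_append, ih, val_conjPos hg, val_cons]; group

theorem val_flatMap_conjNeg (hg : Relations n g) (a : ℕ) (w : BraidWord) :
    val g (w.flatMap (conjNeg n a)) = g a * val g w * (g a)⁻¹ := by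
  induction w with
  | nil => simp
  | cons x w ih => rw [List.flatMap_cons, val_append, ih, val_conjNeg hg, val_cons]; group

/-- The search only moves letters from the reversed prefix to the interior `m`, so the word spelled
by both together never changes. -/
theorem val_of_splitAtNeg {a : ℕ} {l m l' m' : BraidWord}
    (h : splitAtNeg a l m = some (m', l')) :
    val g l.reverse * val g m = val g l'.reverse * (g a)⁻¹ * val g m' := by
  induction l generalizing m with
  | nil => simp [splitAtNeg] at h
  | cons x l ih =>
    cases x with
    | pos b =>
      simp only [splitAtNeg] at h
      split at h
      · simp at h
      · split at h
        · simp at h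
        · simpa [BraidLetter.val, mul_assoc] using ih h
    | neg b =>
      simp only [splitAtNeg] at h
      split at h
      next hb =>
        obtain rfl := Nat.eq_of_beq_eq_true hb
        simp only [Option.some.injEq, Prod.mk.injEq] at h
        simp [BraidLetter.val, h.1, h.2]
      next =>
        split at h
        · simp at h
        · simpa [BraidLetter.val, mul_assoc] using ih h

theorem val_of_splitAtPos {a : ℕ} {l m l' m' : BraidWord}
    (h : splitAtPos a l m = some (m', l')) :
    val g l.reverse * val g m = val g l'.reverse * g a * val g m' := by
  induction l generalizing m with
  | nil => simp [splitAtPos] at h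
  | cons x l ih =>
    cases x with
    | neg b =>
      simp only [splitAtPos] at h
      split at h
      · simp at h
      · split at h
        · simp at h
        · simpa [BraidLetter.val, mul_assoc] using ih h
    | pos b =>
      simp only [splitAtPos] at h
      split at h
      next hb =>
        obtain rfl := Nat.eq_of_beq_eq_true hb
        simp only [Option.some.injEq, Prod.mk.injEq] at h
        simp [BraidLetter.val, h.1, h.2]
      next =>
        split at h
        · simp at h
        · simpa [BraidLetter.val, mul_assoc] using ih h

/-- Each step either moves a letter across the cursor or replaces a handle `a^∓¹ m a^±¹` by the
letterwise conjugate of `m`, so the value is preserved. Termination plays no role: running out of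
steps yields `none`. -/
theorem val_of_handleReduce (hg : Relations n g) {l r w : BraidWord}
    (h : handleReduce n k l r = some w) : val g l.reverse * val g r = val g w.reverse := by
  induction k generalizing l r with
  | zero => simp [handleReduce] at h
  | succ k ih =>
    rcases r with _ | ⟨a | a, r⟩
    · simp only [handleReduce, Option.some.injEq] at h
      simp [h]
    · simp only [handleReduce] at h
      split at h
      next => simpa [mul_assoc] using ih h
      next m l' hm =>
        rw [← ih h, val_append, val_flatMap_conjPos hg, val_cons]
        have := val_of_splitAtNeg (g := g) hm
        rw [val_nil, mul_one] at this
        simp [this, BraidLetter.val, mul_assoc]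
    · simp only [handleReduce] at h
      split at h
      next => simpa [mul_assoc] using ih h
      next m l' hm =>
        rw [← ih h, val_append, val_flatMap_conjNeg hg, val_cons]
        have := val_of_splitAtPos (g := g) hm
        rw [val_nil, mul_one] at this
        simp [this, BraidLetter.val, mul_assoc]

theorem val_of_reducesToOne (hg : Relations n g) {w : BraidWord}
    (h : reducesToOne n k w = true) : val g w = 1 := by
  simp only [reducesToOne] at h
  split at h
  next h' => simpa using val_of_handleReduce hg h'
  next => simp at h

theorem val_eq_of_equal (hg : Relations n g) {u v : BraidWord} (h : equal n k u v = true) :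
    val g u = val g v := by
  have := val_of_reducesToOne hg h
  rwa [val_append, val_inv, mul_inv_eq_one] at this

theorem commute_of_commuting (hg : Relations n g) {u v : BraidWord}
    (h : commuting n k u v = true) : Commute (val g u) (val g v) := by
  have := val_eq_of_equal hg h
  rwa [val_append, val_append] at this

theorem map_val_eq_of_equalLists (hg : Relations n g) {L M : List BraidWord}
    (h : equalLists n k L M = true) : L.map (val g) = M.map (val g) := by
  induction L generalizing M with
  | nil => cases M <;> simp_all [equalLists]
  | cons u L ih =>
    cases M with
    | nil => simp [equalLists] at h
    | cons v M =>
      simp only [equalLists, Bool.and_eq_true] at h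
      simp [val_eq_of_equal hg h.1, ih h.2]

/-! ### From Boolean tests to invariance. -/

theorem isInvariantUnder_of_fixesOrShifts (hg : Relations n g) {h : BraidWord}
    {L : List BraidWord} (H : fixesOrShifts n k h L = true) :
    IsInvariantUnder (L.map (val g)) (val g h) := by
  simp only [fixesOrShifts, Bool.or_eq_true, Bool.and_eq_true, List.all_eq_true] at H
  rcases H with H | ⟨H, K⟩
  · refine isInvariantUnder_of_commute fun x hx => ?_
    obtain ⟨w, hw, rfl⟩ := List.mem_map.1 hx
    exact commute_of_commuting hg (H w hw)
  · refine isInvariantUnder_of_shift ?_ ?_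
    · rw [← List.map_tail, ← map_val_conjAll, map_val_eq_of_equalLists hg H, List.map_dropLast]
    · rw [← val_flatten]
      exact commute_of_commuting hg K

theorem isInvariantUnder_of_fixesOrShiftsBlocks (hg : Relations n g) {h : BraidWord}
    {B : List (List BraidWord × BraidWord)} (H : fixesOrShiftsBlocks n k h B = true) :
    IsInvariantUnder ((blockWords B).map (val g)) (val g h) := by
  induction B with
  | nil => exact HurwitzEquiv.refl _
  | cons b B ih =>
    simp only [fixesOrShiftsBlocks, List.all_cons, Bool.and_eq_true] at H ih
    simp only [blockWords, List.flatMap_cons, List.map_append] at ih ⊢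
    rw [map_val_conjAll]
    exact ((isInvariantUnder_of_fixesOrShifts hg H.1.1).conjList
      (commute_of_commuting hg H.1.2)).append (ih H.2)

theorem commute_of_mem_blockWords (hg : Relations n g) {h : BraidWord}
    {B : List (List BraidWord × BraidWord)}
    (H : (B.all fun b => b.1.all (commuting n k h) && commuting n k h b.2) = true) :
    ∀ x ∈ (blockWords B).map (val g), Commute (val g h) x := by
  intro x hx
  obtain ⟨w, hw, rfl⟩ := List.mem_map.1 hx
  obtain ⟨b, hb, hw⟩ := List.mem_flatMap.1 hw
  obtain ⟨a, ha, rfl⟩ := List.mem_map.1 hw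
  have h1 := List.all_eq_true.1 H b hb
  rw [Bool.and_eq_true, List.all_eq_true] at h1
  have h2 := commute_of_commuting hg h1.2
  rw [val_conj]
  exact ((h2.inv_right).mul_right (commute_of_commuting hg (h1.1 a ha))).mul_right h2

end Correctness

end BraidWord

/-! ## Relations of the half-twists -/

theorem sigma_commute {i j : ℕ} (h : i + 2 ≤ j) : Commute (sigma i) (sigma j) := by
  unfold sigma
  split_ifs with hi hj
  · have := PresentedGroup.one_of_mem (rels := braidRels)
      (Or.inl ⟨⟨i, hi⟩, ⟨j, hj⟩, h, rfl⟩)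
    rw [map_mul, map_inv, mul_inv_eq_one, map_mul, map_mul] at this
    exact this
  · exact Commute.one_right _
  · exact Commute.one_left _
  · exact Commute.one_left _

theorem sigma_braid {i : ℕ} (h : i + 1 < 47) :
    sigma i * sigma (i + 1) * sigma i = sigma (i + 1) * sigma i * sigma (i + 1) := by
  have := PresentedGroup.one_of_mem (rels := braidRels)
    (Or.inr ⟨⟨i, by omega⟩, ⟨i + 1, h⟩, rfl, rfl⟩)
  rw [map_mul, map_inv, mul_inv_eq_one, map_mul, map_mul, map_mul, map_mul] at this
  unfold sigma
  rw [dif_pos h, dif_pos (by omega)]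
  exact this

theorem Z_self_succ (i : ℕ) : Z i (i + 1) = sigma i := by simp [Z]

theorem Z_succ {i j : ℕ} (h : i < j) : Z i (j + 1) = cj (Z i j) (sigma j) := by simp [Z, h]

theorem commute_Z {x : B48} {i j : ℕ} (hij : i < j)
    (h : ∀ k, i ≤ k → k < j → Commute x (sigma k)) : Commute x (Z i j) := by
  induction j, hij using Nat.le_induction with
  | base => rw [Z_self_succ]; exact h i le_rfl (Nat.lt_succ_self i)
  | succ j hij ih =>
    have hs := h j (by omega) (Nat.lt_succ_self j)
    rw [Z_succ hij, cj]
    exact ((hs.inv_right).mul_right (ih fun k h1 h2 => h k h1 (by omega))).mul_right hs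

theorem Z_commute_sigma {i j k : ℕ} (hij : i < j) (hjk : j < k) :
    Commute (Z i j) (sigma k) :=
  (commute_Z hij fun _ _ _ => (sigma_commute (by omega)).symm).symm

theorem Z_commute_Z {i j k l : ℕ} (hij : i < j) (hjk : j < k) (hkl : k < l) :
    Commute (Z i j) (Z k l) :=
  commute_Z hkl fun _ _ _ => Z_commute_sigma hij (by omega)

theorem conj_eq_of_braid {G : Type*} [Group G] {x y : G} (h : x * y * x = y * x * y) :
    y⁻¹ * x * y = x * y * x⁻¹ := by
  rw [eq_mul_inv_iff_mul_eq, mul_assoc, mul_assoc, inv_mul_eq_iff_eq_mul, ← mul_assoc,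
    ← mul_assoc, h]

theorem braid_conj {G : Type*} [Group G] {x y : G} (c : G) (h : x * y * x = y * x * y) :
    c * x * c⁻¹ * (c * y * c⁻¹) * (c * x * c⁻¹) =
      c * y * c⁻¹ * (c * x * c⁻¹) * (c * y * c⁻¹) := by
  simpa [mul_assoc] using congrArg (fun z => c * z * c⁻¹) h

/-- By the previous case, `Z i (j + 1)` is also the conjugate of `sigma j` by `Z i j`. As `sigma (j
+ 1)` commutes with `Z i j`, the relation is a conjugate of Artin's relation for `sigma j` and
`sigma (j + 1)`. -/
theorem Z_braid_sigma {i j : ℕ} (hij : i < j) (hj : j < 47) :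
    Z i j * sigma j * Z i j = sigma j * Z i j * sigma j := by
  induction j, hij using Nat.le_induction with
  | base => rw [Z_self_succ]; exact sigma_braid hj
  | succ j hij ih =>
    rw [Z_succ hij, cj, conj_eq_of_braid (ih (by omega))]
    have h1 := braid_conj (Z i j) (sigma_braid hj)
    rwa [(Z_commute_sigma hij (Nat.lt_succ_self j)).eq, mul_inv_cancel_right] at h1

/-- Extending the second path by `sigma k` conjugates the relation by a generator that commutes with
`Z i j`. -/
theorem Z_braid_Z {i j k : ℕ} (hij : i < j) (hjk : j < k) (hk : k < 48) :
    Z i j * Z j k * Z i j = Z j k * Z i j * Z j k := by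
  induction k, hjk using Nat.le_induction with
  | base => rw [Z_self_succ]; exact Z_braid_sigma hij (by omega)
  | succ k hjk ih =>
    rw [Z_succ hjk, cj]
    have h1 := braid_conj (sigma k)⁻¹ (ih (by omega))
    rwa [← (Z_commute_sigma hij hjk).inv_right.eq, mul_inv_cancel_right, inv_inv] at h1

/-- `Z_{ik} = (Z_{ij}) ^ {Z_{jk}}` for `i < j < k`. -/
theorem Z_trans {i j k : ℕ} (hij : i < j) (hjk : j < k) : Z i k = cj (Z i j) (Z j k) := by
  induction k, hjk using Nat.le_induction with
  | base => rw [Z_succ hij, Z_self_succ]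
  | succ k hjk ih =>
    have h := Z_commute_sigma hij hjk
    rw [Z_succ (hij.trans hjk), Z_succ hjk, ih]
    simp only [cj, mul_inv_rev, inv_inv, mul_assoc]
    rw [← mul_assoc (sigma k) (Z i j), ← h.eq]
    simp [mul_assoc]

/-! ## The twelve points of the 6-point -/

/-- The twelve points `1 < 1' < 2 < 2' < 4 < 4' < 5 < 5' < 13 < 13' < 20 < 20'`. -/
def twelvePoint (k : ℕ) : ℕ := [0, 1, 2, 3, 6, 7, 8, 9, 24, 25, 38, 39].getD k 0

theorem twelvePoint_lt {j : ℕ} (hj : j < 12) : twelvePoint j < 48 := by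
  revert j; decide

theorem twelvePoint_lt_twelvePoint {i j : ℕ} (hij : i < j) (hj : j < 12) :
    twelvePoint i < twelvePoint j := by
  have h : ∀ j < 12, ∀ i < j, twelvePoint i < twelvePoint j := by decide
  exact h j hj i hij

/-- The half-twists of consecutive points among the twelve points. -/
def twelveGen (k : ℕ) : B48 :=
  if k < 11 then Z (twelvePoint k) (twelvePoint (k + 1)) else 1

/-- This allows all computations to be made with twelve strands. The bound 11 matters: the
generators from 11 on are `1`, and the braid relation with them would fail. -/
theorem twelveGen_relations : BraidWord.Relations 11 twelveGen where
  commute i j h := by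
    unfold twelveGen
    split_ifs with hi hj
    · exact Z_commute_Z (twelvePoint_lt_twelvePoint (by omega) (by omega))
        (twelvePoint_lt_twelvePoint (by omega) (by omega))
        (twelvePoint_lt_twelvePoint (by omega) (by omega))
    · exact Commute.one_right _
    · exact Commute.one_left _
    · exact Commute.one_left _
  braid i h := by
    unfold twelveGen
    rw [if_pos h, if_pos (by omega)]
    exact Z_braid_Z (twelvePoint_lt_twelvePoint (by omega) (by omega))
      (twelvePoint_lt_twelvePoint (by omega) (by omega)) (twelvePoint_lt (by omega))

/-! ### Words for the building blocks and their values in `B48`. -/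

namespace BraidWord

/-- The word for the half-twist of the points `i < j`. -/
def halfTwist (i : ℕ) : ℕ → BraidWord
  | 0 => []
  | j + 1 =>
    match Nat.blt i j with
    | true => conj (halfTwist i j) [.pos j]
    | false => [.pos j]

/-- The words for `nodes A B`. -/
def nodes (A B : List ℕ) : List BraidWord :=
  A.reverse.flatMap fun a => B.reverse.map fun b => pow (halfTwist a b) 2

/-- The word for `Z2 A B`. -/
def Z2 (A B : List ℕ) : BraidWord := (nodes A B).flatten

/-- The words for `threeCusps c h`. -/
def threeCusps (c h : BraidWord) : List BraidWord := [conj c h, c, conj c (inv h)]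

/-- The number of the point `j` among the twelve points. -/
def num : ℕ → ℕ
  | 1 => 0
  | 2 => 2
  | 4 => 4
  | 5 => 6
  | 13 => 8
  | _ => 10

/-- The number of the point `j'` among the twelve points. -/
def num' : ℕ → ℕ
  | 1 => 1
  | 2 => 3
  | 4 => 5
  | 5 => 7
  | 13 => 9
  | _ => 11

/-- The numbers of the points `j`, `j'`. -/
def dbl (j : ℕ) : List ℕ := [num j, num' j]

/-- The word for `ZZ j`. -/
def ZZ (j : ℕ) : BraidWord := halfTwist (num j) (num' j)

/-- The words for `cuspsL i b`. -/
def cuspsL (i b : ℕ) : List BraidWord := threeCusps (pow (halfTwist (num i) b) 3) (ZZ i)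

/-- The words for `cuspsR a j`. -/
def cuspsR (a j : ℕ) : List BraidWord := threeCusps (pow (halfTwist a (num j)) 3) (ZZ j)

/-- All paths run below the axis, so by `Z_trans` the recursion may jump over the points outside the
twelve. -/
theorem val_halfTwist {i j : ℕ} (hij : i < j) (hj : j < 12) :
    val twelveGen (halfTwist i j) = Z (twelvePoint i) (twelvePoint j) := by
  induction j, hij using Nat.le_induction with
  | base =>
    have : Nat.blt i i = false := by rw [Bool.eq_false_iff, ne_eq, Nat.blt_eq]; omega
    simp only [halfTwist, this]
    simp [BraidLetter.val, twelveGen, show i < 11 by omega]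
  | succ j hij ih =>
    have : Nat.blt i j = true := by simpa using hij
    simp only [halfTwist, this]
    rw [val_conj, ih (by omega), Z_trans (twelvePoint_lt_twelvePoint hij (by omega))
      (twelvePoint_lt_twelvePoint (Nat.lt_succ_self j) hj), cj]
    simp [BraidLetter.val, twelveGen, show j < 11 by omega]

theorem map_val_nodes {A B : List ℕ} (h : ∀ a ∈ A, ∀ b ∈ B, a < b ∧ b < 12) :
    (nodes A B).map (val twelveGen) = _root_.nodes (A.map twelvePoint) (B.map twelvePoint) := by
  simp only [nodes, _root_.nodes, List.map_flatMap, ← List.map_reverse, List.flatMap_map,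
    List.map_map]
  refine List.flatMap_congr fun a ha => List.map_congr_left fun b hb => ?_
  have := h a (by simpa using ha) b (by simpa using hb)
  simp [val_halfTwist this.1 this.2]

theorem val_Z2 {A B : List ℕ} (h : ∀ a ∈ A, ∀ b ∈ B, a < b ∧ b < 12) :
    val twelveGen (Z2 A B) = _root_.Z2 (A.map twelvePoint) (B.map twelvePoint) := by
  rw [Z2, _root_.Z2, val_flatten, map_val_nodes h]

theorem map_val_conjAll_eq_cjF (L : List BraidWord) (b : BraidWord) :
    (conjAll L b).map (val twelveGen) = cjF (L.map (val twelveGen)) (val twelveGen b) :=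
  map_val_conjAll L b

theorem map_val_threeCusps (c h : BraidWord) :
    (threeCusps c h).map (val twelveGen) =
      _root_.threeCusps (val twelveGen c) (val twelveGen h) := by
  simp [threeCusps, _root_.threeCusps, cj, mul_assoc]

/-- The numbers of the six lines. -/
def lines : List ℕ := [1, 2, 4, 5, 13, 20]

theorem pt_eq {j : ℕ} (hj : j ∈ lines) : pt j = twelvePoint (num j) := by
  revert j; decide

theorem pt'_eq {j : ℕ} (hj : j ∈ lines) : pt' j = twelvePoint (num' j) := by
  revert j; decide

theorem num_lt {j : ℕ} (hj : j ∈ lines) : num j < num' j ∧ num' j < 12 := by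
  revert j; decide

theorem val_ZZ {j : ℕ} (hj : j ∈ lines) : val twelveGen (ZZ j) = _root_.ZZ j := by
  rw [ZZ, _root_.ZZ, val_halfTwist (num_lt hj).1 (num_lt hj).2, pt_eq hj, pt'_eq hj]

theorem map_val_cuspsL {i b : ℕ} (hi : i ∈ lines) (hib : num i < b) (hb : b < 12) :
    (cuspsL i b).map (val twelveGen) = _root_.cuspsL i (twelvePoint b) := by
  rw [cuspsL, _root_.cuspsL, map_val_threeCusps, val_ZZ hi, val_pow,
    val_halfTwist hib hb, pt_eq hi]

theorem map_val_cuspsR {a j : ℕ} (hj : j ∈ lines) (haj : a < num j) :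
    (cuspsR a j).map (val twelveGen) = _root_.cuspsR (twelvePoint a) j := by
  rw [cuspsR, _root_.cuspsR, map_val_threeCusps, val_ZZ hj, val_pow,
    val_halfTwist haj ((num_lt hj).1.trans (num_lt hj).2), pt_eq hj]

end BraidWord

namespace BraidWord

/-! ## The words for `phi2` -/

theorem cjF_one (l : Factorization B48) : cjF l 1 = l := by
  simp [cjF, cj]

/-- The blocks of the factorization `F2`. -/
def F2Blocks : List (List BraidWord × BraidWord) :=
  [(cuspsL 2 (num 13), []),
   (nodes [num' 13] [num 20], []),
   (nodes [num 13] [num 20], Z2 (dbl 2) [num 13]),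
   (cuspsL 2 (num 20), Z2 (dbl 2) [num 13]),
   ([conj (halfTwist (num' 1) (num 2)) (ZZ 1 ++ ZZ 2), halfTwist (num' 1) (num 2)],
      Z2 (dbl 2) [num 20] ++ Z2 (dbl 2) [num 13])]

/-- The blocks of the factorization `G2`. -/
def G2Blocks : List (List BraidWord × BraidWord) :=
  [(nodes [num' 5] (dbl 13), []),
   (cuspsL 2 (num 5), []),
   (cuspsR (num' 5) 20, Z2 [num' 5] (dbl 13)),
   (nodes [num' 5] (dbl 13), inv (Z2 (dbl 13) (dbl 20))),
   ([ZZ 5], Z2 (dbl 2) [num 5] ++ Z2 [num' 5] (dbl 20) ++ Z2 [num' 5] (dbl 13)),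
   (nodes (dbl 1) [num' 5], Z2 [num' 5] (dbl 20) ++ Z2 [num' 5] (dbl 13)),
   (nodes (dbl 1) [num 5], [])]

/-- The blocks of the factors of `phi2` which involve the points `4` and `4'`. -/
def H2Blocks : List (List BraidWord × BraidWord) :=
  [(nodes (dbl 2) [num 4], []),
   (nodes [num' 4] (dbl 5), []),
   (cuspsL 1 (num 4), []),
   (cuspsR (num' 4) 13, Z2 [num' 4] (dbl 5)),
   (nodes (dbl 2) [num 4], Z2 (dbl 1) [num 4]),
   (nodes [num' 4] (dbl 5), inv (Z2 (dbl 5) (dbl 13))),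
   ([ZZ 4], Z2 [num' 4] (dbl 13) ++ Z2 [num' 4] (dbl 5) ++ Z2 (dbl 2) [num 4] ++
      Z2 (dbl 1) [num 4]),
   (nodes [num 4] (dbl 20), Z2 [num 4] (dbl 13) ++ Z2 [num 4] (dbl 5) ++ pow (ZZ 4) 2 ++
      Z2 (dbl 2) [num 4] ++ Z2 (dbl 1) [num 4]),
   (nodes [num' 4] (dbl 20), Z2 [num' 4] (dbl 13) ++ Z2 [num' 4] (dbl 5))]

/-- The word for `Z²_{22',5} Z²_{11',5}`. -/
def K5 : BraidWord := Z2 (dbl 2) [num 5] ++ Z2 (dbl 1) [num 5]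

/-- The word for `Z²_{22',4} Z²_{11',4}`. -/
def K4 : BraidWord := Z2 (dbl 2) [num 4] ++ Z2 (dbl 1) [num 4]

/-- The word for `Z_{44'} Z_{55'}`. -/
def twist45 : BraidWord := ZZ 4 ++ ZZ 5

/-- The word for `Z_{13 13'} Z_{20 20'}`. -/
def twist1320 : BraidWord := ZZ 13 ++ ZZ 20

/-- The word for `Z_{11'} Z_{22'}`. -/
def twist12 : BraidWord := ZZ 1 ++ ZZ 2

/-- A word for the full twist of the twelve points. -/
def fullTwist : BraidWord := pow ((List.range 11).map .pos) 12

/-- A word for the full twist of the points `1, 1', 2, 2', 13, 13', 20, 20'`. -/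
def fullTwistEight : BraidWord :=
  pow (((List.range 3).map .pos) ++ halfTwist 3 8 ++ [.pos 8, .pos 9, .pos 10]) 8

/-- The word for the product of `phi2`. -/
def phi2Prod : BraidWord :=
  blockProd H2Blocks ++
    conj (blockProd G2Blocks ++
      conj (blockProd F2Blocks ++ conj (blockProd F2Blocks) (inv twist1320)) K5) K4

theorem map_val_blockWords_F2Blocks :
    (blockWords F2Blocks).map (val twelveGen) = F2 := by
  simp only [F2Blocks, blockWords, List.flatMap_cons, List.flatMap_nil, List.map_append,
    map_val_conjAll_eq_cjF, val_nil, cjF_one, List.append_nil, val_append]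
  rw [map_val_cuspsL (i := 2) (by decide) (by decide) (by decide),
    map_val_cuspsL (i := 2) (by decide) (by decide) (by decide),
    map_val_nodes (by decide), map_val_nodes (by decide), val_Z2 (by decide),
    val_Z2 (by decide), List.map_cons (f := val twelveGen),
    List.map_cons (f := val twelveGen), val_conj, val_append,
    val_halfTwist (by decide) (by decide), val_ZZ (by decide), val_ZZ (by decide)]
  simp only [F2, List.append_assoc]
  -- What remains is to evaluate the numbering of the twelve points at numerals.
  rfl

theorem map_val_blockWords_G2Blocks :
    (blockWords G2Blocks).map (val twelveGen) = G2 := by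
  simp only [G2Blocks, blockWords, List.flatMap_cons, List.flatMap_nil, List.map_append,
    map_val_conjAll_eq_cjF, val_nil, cjF_one, List.append_nil, val_append, val_inv]
  rw [map_val_cuspsL (i := 2) (by decide) (by decide) (by decide),
    map_val_cuspsR (j := 20) (by decide) (by decide),
    map_val_nodes (by decide), map_val_nodes (by decide), map_val_nodes (by decide),
    val_Z2 (by decide), val_Z2 (by decide), val_Z2 (by decide), val_Z2 (by decide),
    List.map_cons (f := val twelveGen), val_ZZ (by decide)]
  simp only [G2, List.append_assoc]
  rfl

theorem phi2_eq :
    phi2 = (blockWords H2Blocks).map (val twelveGen) ++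
      conjList (G2 ++ conjList (F2 ++ conjList F2 (val twelveGen twist1320)⁻¹)
        (val twelveGen K5)) (val twelveGen K4) := by
  have h : (val twelveGen twist1320)⁻¹ = (_root_.ZZ 20)⁻¹ * (_root_.ZZ 13)⁻¹ := by
    rw [twist1320, val_append, val_ZZ (by decide), val_ZZ (by decide), mul_inv_rev]
  rw [h, K4, K5, val_append, val_append]
  simp only [H2Blocks, blockWords, List.flatMap_cons, List.flatMap_nil, List.map_append,
    map_val_conjAll_eq_cjF, val_nil, cjF_one, List.append_nil, val_append, val_inv, val_pow]
  rw [map_val_cuspsL (i := 1) (by decide) (by decide) (by decide),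
    map_val_cuspsR (j := 13) (by decide) (by decide),
    map_val_nodes (by decide), map_val_nodes (by decide), map_val_nodes (by decide),
    map_val_nodes (by decide), val_Z2 (by decide), val_Z2 (by decide), val_Z2 (by decide),
    val_Z2 (by decide), val_Z2 (by decide), val_Z2 (by decide), val_Z2 (by decide),
    val_Z2 (by decide), val_Z2 (by decide),
    List.map_cons (f := val twelveGen), val_ZZ (by decide)]
  simp only [phi2, List.append_assoc]
  rfl

end BraidWord

namespace BraidWord

/-! ## Invariance of `phi2` -/

/-- A bound on the number of steps of handle reduction. -/
def steps : ℕ := 100000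

theorem fixesOrShifts_F2Blocks : fixesOrShiftsBlocks 11 steps twist12 F2Blocks = true := by
  decide +kernel

theorem fixesOrShifts_G2Blocks :
    (fixesOrShiftsBlocks 11 steps twist12 G2Blocks &&
      fixesOrShiftsBlocks 11 steps twist1320 G2Blocks) = true := by
  decide +kernel

theorem fixesOrShifts_H2Blocks :
    (fixesOrShiftsBlocks 11 steps twist12 H2Blocks &&
      fixesOrShiftsBlocks 11 steps twist1320 H2Blocks) = true := by
  decide +kernel

theorem commuting_twists :
    (commuting 11 steps twist12 twist1320 && commuting 11 steps twist12 K5 &&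
      commuting 11 steps twist12 K4 && commuting 11 steps twist1320 K5 &&
      commuting 11 steps twist1320 K4) = true := by
  decide +kernel

/-- This is the identity `(P b)² c² = Δ²` on eight strands, which makes
`isInvariantUnder_append_conjList` applicable to `F2`. -/
theorem equal_fullTwistEight :
    equal 11 steps (blockProd F2Blocks ++ twist1320 ++ blockProd F2Blocks ++ twist1320 ++
      pow twist12 2) fullTwistEight = true := by
  decide +kernel

theorem fullTwistEight_commuting_F2Blocks :
    (F2Blocks.all fun b => b.1.all (commuting 11 steps fullTwistEight) &&
      commuting 11 steps fullTwistEight b.2) = true := by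
  decide +kernel

theorem equal_fullTwist :
    equal 11 steps (phi2Prod ++ twist45 ++ twist1320 ++ twist12) fullTwist = true := by
  decide +kernel

theorem fullTwist_commuting :
    ((List.range 11).all fun i => commuting 11 steps fullTwist [.pos i]) = true := by
  decide +kernel

/-- The full twist of twelve points is not claimed to be central in `B48`; commuting with the eleven
half-twists gives it for all words in them. -/
theorem commute_fullTwist (w : BraidWord) :
    Commute (val twelveGen fullTwist) (val twelveGen w) := by
  have h (i : ℕ) : Commute (val twelveGen fullTwist) (twelveGen i) := by
    by_cases hi : i < 11
    · have := commute_of_commuting twelveGen_relations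
        (List.all_eq_true.1 fullTwist_commuting i (List.mem_range.2 hi))
      simpa [BraidLetter.val] using this
    · simp [twelveGen, hi]
  induction w with
  | nil => exact Commute.one_right _
  | cons x w ih =>
    rw [val_cons]
    refine Commute.mul_right ?_ ih
    cases x with
    | pos i => exact h i
    | neg i => exact (h i).inv_right

theorem isInvariantUnder_phi2 {h : BraidWord}
    (hH : fixesOrShiftsBlocks 11 steps h H2Blocks = true)
    (hG : fixesOrShiftsBlocks 11 steps h G2Blocks = true)
    (h5 : commuting 11 steps h K5 = true) (h4 : commuting 11 steps h K4 = true)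
    (hF : IsInvariantUnder (F2 ++ conjList F2 (val twelveGen twist1320)⁻¹) (val twelveGen h)) :
    IsInvariantUnder phi2 (val twelveGen h) := by
  have hG' := isInvariantUnder_of_fixesOrShiftsBlocks twelveGen_relations hG
  rw [map_val_blockWords_G2Blocks] at hG'
  rw [phi2_eq]
  exact (isInvariantUnder_of_fixesOrShiftsBlocks twelveGen_relations hH).append
    ((hG'.append (hF.conjList (commute_of_commuting twelveGen_relations h5))).conjList
      (commute_of_commuting twelveGen_relations h4))

theorem isInvariantUnder_F2 : IsInvariantUnder F2 (val twelveGen twist12) := by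
  rw [← map_val_blockWords_F2Blocks]
  exact isInvariantUnder_of_fixesOrShiftsBlocks twelveGen_relations fixesOrShifts_F2Blocks

theorem val_blockProd_F2Blocks : val twelveGen (blockProd F2Blocks) = F2.prod := by
  rw [val_blockProd, map_val_blockWords_F2Blocks]

theorem isInvariantUnder_phi2_twist12 : IsInvariantUnder phi2 (val twelveGen twist12) := by
  have hG := fixesOrShifts_G2Blocks
  have hH := fixesOrShifts_H2Blocks
  have hc := commuting_twists
  simp only [Bool.and_eq_true] at hG hH hc
  exact isInvariantUnder_phi2 hH.1 hG.1 hc.1.1.1.2 hc.1.1.2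
    (isInvariantUnder_F2.append (isInvariantUnder_F2.conjList
      (commute_of_commuting twelveGen_relations hc.1.1.1.1).inv_right))

theorem isInvariantUnder_phi2_twist1320 : IsInvariantUnder phi2 (val twelveGen twist1320) := by
  have hG := fixesOrShifts_G2Blocks
  have hH := fixesOrShifts_H2Blocks
  have hc := commuting_twists
  simp only [Bool.and_eq_true] at hG hH hc
  refine isInvariantUnder_phi2 hH.2 hG.2 hc.1.2 hc.2
    -- The auxiliary braid is the square of `twist12`, as it occurs in `equal_fullTwistEight`.
    (isInvariantUnder_append_conjList (isInvariantUnder_F2.mul isInvariantUnder_F2) ?_)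
  have h1 := val_eq_of_equal twelveGen_relations equal_fullTwistEight
  simp only [val_append, val_pow, val_blockProd_F2Blocks, pow_two] at h1
  rw [h1]
  have h2 := commute_of_mem_blockWords twelveGen_relations fullTwistEight_commuting_F2Blocks
  rwa [map_val_blockWords_F2Blocks] at h2

theorem val_phi2Prod : val twelveGen phi2Prod = phi2.prod := by
  rw [phi2_eq]
  simp only [phi2Prod, val_append, val_conj, val_inv, val_blockProd,
    map_val_blockWords_F2Blocks, map_val_blockWords_G2Blocks, List.prod_append, prod_conjList]

/-- Needed to apply `commute_fullTwist` to the factors of `phi2`. -/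
theorem mem_phi2 {x : B48} (hx : x ∈ phi2) : ∃ w, val twelveGen w = x := by
  rw [phi2_eq, ← map_val_blockWords_G2Blocks, ← map_val_blockWords_F2Blocks, ← val_inv,
    ← map_val_conjAll, ← List.map_append, ← map_val_conjAll, ← List.map_append,
    ← map_val_conjAll, ← List.map_append] at hx
  obtain ⟨w, -, rfl⟩ := List.mem_map.1 hx
  exact ⟨w, rfl⟩

theorem isInvariantUnder_phi2_twist45 : IsInvariantUnder phi2 (val twelveGen twist45) := by
  have h1 : IsInvariantUnder phi2 (val twelveGen fullTwist) := by
    refine isInvariantUnder_of_commute fun x hx => ?_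
    obtain ⟨w, rfl⟩ := mem_phi2 hx
    exact commute_fullTwist w
  have h2 := val_eq_of_equal twelveGen_relations equal_fullTwist
  simp only [val_append, val_phi2Prod] at h2
  -- Solving `phi2.prod · a b c = Δ²` for `a` gives `a = phi2.prod⁻¹ Δ² c⁻¹ b⁻¹`.
  have h3 := (((isInvariantUnder_prod phi2).inv.mul h1).mul
    isInvariantUnder_phi2_twist12.inv).mul isInvariantUnder_phi2_twist1320.inv
  rw [← h2] at h3
  convert h3 using 1
  group

end BraidWord

theorem mainTheorem6 (p q r : ℤ) :
    IsInvariantUnder phi2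
      ((ZZ 4 * ZZ 5) ^ p * (ZZ 13 * ZZ 20) ^ q * (ZZ 1 * ZZ 2) ^ r) := by
  have h1 := BraidWord.isInvariantUnder_phi2_twist45
  have h2 := BraidWord.isInvariantUnder_phi2_twist1320
  have h3 := BraidWord.isInvariantUnder_phi2_twist12
  simp only [BraidWord.twist45, BraidWord.twist1320, BraidWord.twist12,
    BraidWord.val_append] at h1 h2 h3
  rw [BraidWord.val_ZZ (by decide), BraidWord.val_ZZ (by decide)] at h1 h2 h3
  exact ((h1.zpow p).mul (h2.zpow q)).mul (h3.zpow r)
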